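/- Let $k$ be a field, $G$ a finite group, and $M$ a finite dimensional indecomposable $kG$-module. Let $P\le G$ be a vertex of $M$ (a subgroup minimal under inclusion among those $H\le G$ such that $M$ is a direct summand of a module induced from $H$) and let $U$ be a source of $M$ (a finite dimensional indecomposable $kP$-module such that $M$ is a summand of $U\!\uparrow_P^G$). Let $I=\{g\in N_G(P) : {}^gU\cong U\}$ be the inertia group; note that $P\le I$. Let $Y$ be an indecomposable $kI$-module that is a summand of $U\!\uparrow_P^I$ and such that $M$ is a summand of $Y\!\uparrow_I^G$. For a group $H$, a finite dimensional indecomposable $kH$-module $N$ and any $kH$-module $X$, let $\operatorname{Hom}^{\oplus}_{kH}(N,X)$ be the quotient of $\operatorname{Hom}_{kH}(N,X)$ by the subspace of homomorphisms that are not split injective; it is a functor of $X$ with values in $k$-vector spaces. Then the functors $\operatorname{Hom}^{\oplus}_{kG}(M,-)$ and $\operatorname{Hom}^{\oplus}_{kI}(Y,-\!\downarrow^G_I)$, from the category of all (possibly infinite dimensional) $kG$-modules to the category of $k$-vector spaces, are naturally isomorphic. -/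

import Mathlib

open CategoryTheory CategoryTheory.Limits

universe u

namespace ModRep

noncomputable section

/-! Throughout, `Rep.{u} k G` is the category of all (possibly infinite dimensional) `kG`-modules.
An object `X` is isomorphic to a direct summand of `Y` iff there is a `Retract X Y`, a morphism is a
split injection iff it is a split monomorphism, and `Indecomposable` (from Mathlib) means nonzero
and not isomorphic to a direct sum of two nonzero objects. -/

section HomSum

variable {k : Type u} [Field k] {G : Type u} [Group G]

/-- `X` is isomorphic to a direct summand of `Y`. -/
def IsSummand (X Y : Rep.{u} k G) : Prop :=
  Nonempty (Retract X Y)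

/-- The subspace of `Hom_{kG}(M, X)` generated by the homomorphisms that are not split injective.
For `M` finite dimensional and indecomposable it consists of exactly these homomorphisms, see
`mem_nonSplit_iff`. -/
def nonSplit (M X : Rep.{u} k G) : Submodule k (M ⟶ X) :=
  Submodule.span k {f | ¬ IsSplitMono f}

lemma nonSplit_comp (M : Rep.{u} k G) {X X' : Rep.{u} k G} (h : X ⟶ X') :
    nonSplit M X ≤ (nonSplit M X').comap (Linear.rightComp k M h) := by
  refine Submodule.span_le.2 fun f hf => Submodule.subset_span fun hs => hf ?_
  exact ⟨⟨h ≫ hs.exists_splitMono.some.retraction, by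
    simpa using hs.exists_splitMono.some.id⟩⟩

/-- The functor `Hom^⊕_{kG}(M, -)`: all `kG`-homomorphisms out of `M` modulo those that are not
split injective, with functoriality by composition. -/
def homSum (M : Rep.{u} k G) : Rep.{u} k G ⥤ ModuleCat.{u} k where
  obj X := ModuleCat.of k ((M ⟶ X) ⧸ nonSplit M X)
  map {X X'} h := ModuleCat.ofHom
    ((nonSplit M X).mapQ (nonSplit M X') (Linear.rightComp k M h) (nonSplit_comp M h))
  map_id X := by
    ext f
    simp
  map_comp h h' := by
    ext f
    simp

/-- An idempotent endomorphism of an indecomposable object is `0` or `1`. -/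
lemma idem_eq_zero_or_one {M : Rep.{u} k G} (hM : Indecomposable M) (e : M ⟶ M)
    (he : e ≫ e = e) : e = 0 ∨ e = 𝟙 M := by
  obtain ⟨Y, i, r, h1, h2⟩ := IsIdempotentComplete.idempotents_split M e he
  obtain ⟨Z, j, s, h3, h4⟩ := IsIdempotentComplete.idempotents_split M (𝟙 M - e)
    (by simp [Preadditive.sub_comp, Preadditive.comp_sub, he])
  have hie : i ≫ e = i := by rw [← h2, ← Category.assoc, h1, Category.id_comp]
  have hes : e ≫ s = 0 := by
    have : e ≫ (s ≫ j) ≫ s = 0 := by rw [h4]; simp [Preadditive.sub_comp, Preadditive.comp_sub, reassoc_of% he]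
    simpa [h3] using this
  have hje : j ≫ e = 0 := by
    have : j ≫ (s ≫ j) ≫ e = 0 := by rw [h4]; simp [Preadditive.sub_comp, he]
    simpa [reassoc_of% h3] using this
  have his : i ≫ s = 0 := by rw [← hie, Category.assoc, hes, comp_zero]
  have hjr : j ≫ r = 0 := by
    have : j ≫ (r ≫ i) ≫ r = 0 := by rw [h2, ← Category.assoc, hje, zero_comp]
    simpa [h1] using this
  let b : BinaryBicone Y Z :=
    { pt := M, fst := r, snd := s, inl := i, inr := j
      inl_fst := h1, inl_snd := his, inr_fst := hjr, inr_snd := h3 }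
  have hb : b.IsBilimit := isBinaryBilimitOfTotal b (by
    change r ≫ i + s ≫ j = 𝟙 M
    rw [h2, h4]; abel)
  rcases hM.2 Y Z (biprod.uniqueUpToIso Y Z hb) with h | h
  · left; rw [← h2, h.eq_of_tgt r 0, zero_comp]
  · right
    have : s ≫ j = 0 := by rw [h.eq_of_tgt s 0, zero_comp]
    rw [this] at h4
    exact (sub_eq_zero.1 h4.symm).symm

/-- In a commutative artinian ring every element is invertible modulo a nilpotent part, and an
idempotent detects which. -/
lemma exists_idem {B : Type*} [CommRing B] [IsArtinianRing B] (a : B) :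
    ∃ e : B, e * e = e ∧ (e = 0 → IsNilpotent a) ∧ (e = 1 → IsUnit a) := by
  obtain ⟨n, y, hy⟩ := IsArtinian.exists_pow_succ_smul_dvd a (1 : B)
  simp only [smul_eq_mul, mul_one] at hy
  have key : ∀ m : ℕ, a ^ n = y ^ m * a ^ (n + m) := by
    intro m
    induction m with
    | zero => simp
    | succ m ih =>
      calc a ^ n = y ^ m * (a ^ n * a ^ m) := by rw [← pow_add]; exact ih
        _ = y ^ m * ((a ^ n.succ * y) * a ^ m) := by rw [hy]
        _ = _ := by rw [Nat.succ_eq_add_one]; ring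
  have hk := key (n + 1)
  have hk' : a ^ (n + 1) = y ^ (n + 1) * (a ^ (n + 1) * a ^ (n + 1)) := by
    calc a ^ (n + 1) = a ^ n * a := pow_succ _ _
      _ = (y ^ (n + 1) * a ^ (n + (n + 1))) * a := by rw [← hk]
      _ = _ := by ring
  refine ⟨y ^ (n + 1) * a ^ (n + 1), ?_, fun h => ⟨n + 1, ?_⟩, fun h => ?_⟩
  · calc _ = y ^ (n + 1) * (y ^ (n + 1) * (a ^ (n + 1) * a ^ (n + 1))) := by ring
      _ = _ := by rw [← hk']
  · rw [hk', ← mul_assoc, h, zero_mul]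
  · refine IsUnit.of_mul_eq_one (y ^ (n + 1) * a ^ n) ?_
    rw [← h]; ring

/-- An endomorphism of a finite dimensional indecomposable module is nilpotent or invertible. -/
lemma nilpotent_or_unit {M : Rep.{u} k G} [Module.Finite k M] (hM : Indecomposable M)
    (a : End M) : IsNilpotent a ∨ IsUnit a := by
  let φ : (M ⟶ M) →ₗ[k] (M →ₗ[k] M) :=
    { toFun := fun f => f.hom.toLinearMap
      map_add' := fun _ _ => rfl
      map_smul' := fun _ _ => rfl }
  have hφ : Function.Injective φ := fun f g h => by
    ext x; exact LinearMap.congr_fun h x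
  have : Module.Finite k (End M) := Module.Finite.of_injective φ hφ
  have hcomm : IsMulCommutative (Algebra.adjoin k {a}) :=
    Algebra.isMulCommutative_adjoin k (by simp)
  have : Module.Finite k (Algebra.adjoin k {a}) :=
    Module.Finite.of_injective (Algebra.adjoin k {a}).val.toLinearMap Subtype.val_injective
  have : IsArtinianRing (Algebra.adjoin k {a}) := IsArtinianRing.of_finite k _
  obtain ⟨e, he, h0, h1⟩ := exists_idem
    (⟨a, Algebra.subset_adjoin (Set.mem_singleton a)⟩ : Algebra.adjoin k {a})
  have he' : (e : End M) * (e : End M) = e := congrArg Subtype.val he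
  rcases idem_eq_zero_or_one hM (e : End M) he' with h | h
  · exact Or.inl ((h0 (Subtype.ext h)).map (Algebra.adjoin k {a}).val)
  · exact Or.inr ((h1 (Subtype.ext h)).map (Algebra.adjoin k {a}).val)

/-- For `M` finite dimensional and indecomposable, the subspace `nonSplit M X` is precisely the set
of homomorphisms that are not split injective. -/
lemma mem_nonSplit_iff {M : Rep.{u} k G} [Module.Finite k M] (hM : Indecomposable M)
    {X : Rep.{u} k G} (f : M ⟶ X) : f ∈ nonSplit M X ↔ ¬ IsSplitMono f := by
  refine ⟨fun hf => ?_, fun hf => Submodule.subset_span hf⟩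
  have hsplit : ∀ (g : M ⟶ X) (s : X ⟶ M), IsUnit (End.of (g ≫ s)) → IsSplitMono g := by
    intro g s hu
    have : IsIso (g ≫ s) := (isUnit_iff_isIso _).1 hu
    exact ⟨⟨s ≫ inv (g ≫ s), by rw [← Category.assoc, IsIso.hom_inv_id]⟩⟩
  induction hf using Submodule.span_induction with
  | mem x h => exact h
  | zero =>
    rintro ⟨⟨s⟩⟩
    refine hM.1 ((IsZero.iff_id_eq_zero M).2 ?_)
    rw [← s.id, zero_comp]
  | add x y _ _ hx hy =>
    rintro ⟨⟨s⟩⟩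
    have h1 : End.of (x ≫ s.retraction) + End.of (y ≫ s.retraction) = 1 := by
      have := s.id
      rwa [Preadditive.add_comp] at this
    rcases nilpotent_or_unit hM (End.of (x ≫ s.retraction)) with h | h
    · refine hy (hsplit y s.retraction ?_)
      rw [eq_sub_of_add_eq' h1]
      exact h.isUnit_one_sub
    · exact hx (hsplit x s.retraction h)
  | smul c x _ hx =>
    rintro ⟨⟨s⟩⟩
    refine hx ⟨⟨c • s.retraction, ?_⟩⟩
    rw [Linear.comp_smul, ← Linear.smul_comp]
    exact s.id

end HomSum

section Vertex

variable {k : Type u} [Field k] {G : Type u} [Group G]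

/-- The induced module `N ↑_H^G` of a module for a subgroup. -/
abbrev induced {H : Subgroup G} (N : Rep.{u} k H) : Rep.{u} k G :=
  Rep.ind H.subtype N

/-- The restriction functor `- ↓_H^G` to a subgroup. -/
abbrev restrict (k : Type u) [Field k] {G : Type u} [Group G] (H : Subgroup G) :
    Rep.{u} k G ⥤ Rep.{u} k H :=
  Rep.resFunctor H.subtype

/-- `M` is relatively `H`-projective: it is a summand of a module induced from `H`. -/
def IsRelProjective (H : Subgroup G) (M : Rep.{u} k G) : Prop :=
  ∃ N : Rep.{u} k H, IsSummand M (induced N)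

/-- `P` is a vertex of `M`: it is minimal under inclusion among the subgroups `H` such that `M` is
relatively `H`-projective. -/
def IsVertex (P : Subgroup G) (M : Rep.{u} k G) : Prop :=
  Minimal (fun H : Subgroup G => IsRelProjective H M) P

/-- For `P` a vertex of `M`, the `kP`-module `U` is a source of `M`: it is a finite dimensional
indecomposable module such that `M` is a summand of the module induced from `U`. -/
structure IsSource {P : Subgroup G} (U : Rep.{u} k P) (M : Rep.{u} k G) : Prop where
  finite : Module.Finite k U
  indecomposable : Indecomposable U
  isSummand : IsSummand M (induced U)

/-- The conjugate module `^g U` of a `kP`-module for `g` in the normalizer of `P`: the space `U`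
on which `x` acts as `g⁻¹ * x * g` did. -/
def conjugate {P : Subgroup G} (g : Subgroup.normalizer (P : Set G)) (U : Rep.{u} k P) :
    Rep.{u} k P :=
  Rep.res (P.normalizerMonoidHom g⁻¹).toMonoidHom U

lemma conjugate_ρ {P : Subgroup G} (g : Subgroup.normalizer (P : Set G)) (U : Rep.{u} k P)
    (x y : P) (h : (y : G) = (g : G)⁻¹ * x * g) : (conjugate g U).ρ x = U.ρ y := by
  have : y = P.normalizerMonoidHom g⁻¹ x := Subtype.ext (by simp [h])
  rw [this]; rfl

lemma conjugate_one {P : Subgroup G} (U : Rep.{u} k P) : conjugate 1 U = U := by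
  simp only [conjugate, inv_one, map_one]
  rfl

lemma conjugate_mul {P : Subgroup G} (g h : Subgroup.normalizer (P : Set G)) (U : Rep.{u} k P) :
    conjugate (g * h) U = conjugate g (conjugate h U) := by
  simp only [conjugate, mul_inv_rev, map_mul]
  rfl

/-- Conjugation respects isomorphism. -/
def conjugateIso {P : Subgroup G} (g : Subgroup.normalizer (P : Set G)) {U V : Rep.{u} k P}
    (e : U ≅ V) : conjugate g U ≅ conjugate g V :=
  (Rep.resFunctor (P.normalizerMonoidHom g⁻¹).toMonoidHom).mapIso e

/-- The inertia group of the `kP`-module `U`: the stabilizer of its isomorphism class in the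
normalizer of `P` in `G`. -/
def inertia {P : Subgroup G} (U : Rep.{u} k P) : Subgroup G where
  carrier := {g | ∃ hg : g ∈ Subgroup.normalizer (P : Set G), Nonempty (conjugate ⟨g, hg⟩ U ≅ U)}
  one_mem' := ⟨one_mem _, ⟨eqToIso (conjugate_one U)⟩⟩
  mul_mem' := by
    rintro a b ⟨ha, ⟨e⟩⟩ ⟨hb, ⟨f⟩⟩
    exact ⟨mul_mem ha hb, ⟨eqToIso (conjugate_mul ⟨a, ha⟩ ⟨b, hb⟩ U) ≪≫ conjugateIso _ f ≪≫ e⟩⟩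
  inv_mem' := by
    rintro a ⟨ha, ⟨e⟩⟩
    have h : conjugate ⟨a⁻¹, inv_mem ha⟩ (conjugate ⟨a, ha⟩ U) = U := by
      rw [← conjugate_mul]
      exact (congrArg (conjugate · U) (inv_mul_cancel (⟨a, ha⟩ : Subgroup.normalizer _))).trans
        (conjugate_one U)
    exact ⟨inv_mem ha, ⟨conjugateIso _ e.symm ≪≫ eqToIso h⟩⟩

/-- Inner automorphisms of `P` fix the isomorphism class of `U`. -/
lemma le_inertia {P : Subgroup G} (U : Rep.{u} k P) : P ≤ inertia U := by
  intro g hg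
  have hn : g ∈ Subgroup.normalizer (P : Set G) := Subgroup.le_normalizer hg
  refine ⟨hn, ?_⟩
  let a : P := ⟨g, hg⟩
  have hx : ∀ x : P, (conjugate ⟨g, hn⟩ U).ρ x = U.ρ (a⁻¹ * x * a) := fun x =>
    conjugate_ρ _ U x _ rfl
  have h1 : U.ρ a * U.ρ a⁻¹ = 1 := by rw [← map_mul, mul_inv_cancel, map_one]
  have h2 : U.ρ a⁻¹ * U.ρ a = 1 := by rw [← map_mul, inv_mul_cancel, map_one]
  let e : (conjugate ⟨g, hn⟩ U).ρ.Equiv U.ρ :=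
    .mk (LinearEquiv.ofLinearMap (U.ρ a) (U.ρ a⁻¹) h1 h2) fun x => by
      rw [hx]
      change U.ρ a * U.ρ (a⁻¹ * x * a) = U.ρ x * U.ρ a
      rw [← map_mul, ← map_mul]
      congr 1
      group
  exact ⟨Rep.mkIso e⟩

/-- The module induced from `P` to the inertia group. -/
abbrev inducedToInertia {P : Subgroup G} (U : Rep.{u} k P) : Rep.{u} k (inertia U) :=
  Rep.ind (Subgroup.inclusion (le_inertia U)) U

end Vertex

end

end ModRep

/-! The natural isomorphism is composition with the map `r : Y ⟶ M↓_I` that, together with some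
`i : M↓_I ⟶ Y`, realizes `M` as a summand of `Y↑^G`. By Higman's criterion
(`exists_sum_of_isSummand_ind`, `isSummand_ind_res_of_sum`) this means that the sum of the
conjugates of `i ≫ r` over `G / I`, its relative trace, is the identity of `M`.

All computations are made modulo the two-sided ideal of `U`-null maps, those killed by the functor
`Hom^⊕(U, -)` on the restrictions to `P`. The point is that the relative trace of a map through `Y`
is congruent to that map (`null_relTrace_sub`): the remaining terms, indexed by the cosets outside
`I`, are null. Indeed, otherwise the identity of `U` is a sum of such terms; grouping these by
`P`-orbits of cosets `xP`, and because `End U` is local, one orbit sum is invertible. Then `U` is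
projective relative to the stabilizer of `xP`, hence so is `M`, and minimality of the vertex forces
`x` to normalize `P` (`exists_normalizing_coset`). The single term of the orbit identifies `U` with
its conjugate by `x`, so `x` lies in `I`.

The other input is that `U` is a summand of `M↓_P`, that is, that the identity of `M` is not null
(`IsVertex.isSummand_res`, `not_null_id`). Now `i ≫ r` is congruent to the identity, so `r ≫ i` is
not nilpotent and hence is an automorphism of `Y`. If `r ≫ f` is split by `s`, then the relative
trace of `f ≫ s ≫ r` is an endomorphism of `M` that is congruent to the identity, hence is
invertible, and it factors through `f`; so `f` is split. If `g : Y ⟶ X↓_I` is arbitrary, then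
`r ≫ f` is congruent to `g` for `f` the relative trace of `i ≫ (r ≫ i)⁻¹ ≫ g`; as the identity of
`Y` is not null, the difference is not split. -/

namespace ModRep

noncomputable section

/-! ### Conjugation of linear maps and Higman's criterion -/

section RelativeTrace

variable {k : Type u} [Field k] {G H : Type u} [Group G] [Group H]

/-- The conjugate `g f g⁻¹` of a linear map `f` between representations of `G`. -/
abbrev conj (X X' : Rep.{u} k G) (g : G) (f : X →ₗ[k] X') : X →ₗ[k] X' :=
  X.ρ.linHom X'.ρ g f

lemma conj_mul (X X' : Rep.{u} k G) (g h : G) (f : X →ₗ[k] X') :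
    conj X X' (g * h) f = conj X X' g (conj X X' h f) := by
  simp only [conj, map_mul, Module.End.mul_apply]

/-- A linear map that is fixed by conjugation with a subgroup `K` has the same conjugate for any
two representatives of a left coset of `K`. -/
lemma conj_out {X X' : Rep.{u} k G} {K : Subgroup G} {f : X →ₗ[k] X'}
    (hf : ∀ g ∈ K, conj X X' g f = f) (g : G) :
    conj X X' (QuotientGroup.mk (s := K) g).out f = conj X X' g f := by
  obtain ⟨h, hh⟩ := QuotientGroup.mk_out_eq_mul K g
  rw [hh, conj_mul, hf _ h.2]

lemma conj_out_smul {X X' : Rep.{u} k G} {K : Subgroup G} {f : X →ₗ[k] X'}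
    (hf : ∀ g ∈ K, conj X X' g f = f) (g : G) (q : G ⧸ K) :
    conj X X' (g • q).out f = conj X X' g (conj X X' q.out f) := by
  obtain ⟨x, rfl⟩ := QuotientGroup.mk_surjective q
  rw [← MulAction.Quotient.coe_smul_out, conj_out hf, smul_eq_mul, conj_mul]

lemma conj_comp {X X' X'' : Rep.{u} k G} (g : G) (f : X →ₗ[k] X') (f' : X' →ₗ[k] X'') :
    conj X X'' g (f' ∘ₗ f) = conj X' X'' g f' ∘ₗ conj X X' g f := by
  ext x
  simp [conj]

lemma conj_hom {X X' : Rep.{u} k G} (g : G) (f : X ⟶ X') :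
    conj X X' g f.hom.toLinearMap = f.hom.toLinearMap := by
  ext x
  simp [conj, ← Rep.hom_comm_apply]

/-- A linear map fixed by conjugation is a morphism of representations. -/
def homOfConj {X X' : Rep.{u} k G} (f : X →ₗ[k] X') (hf : ∀ g, conj X X' g f = f) : X ⟶ X' :=
  Rep.ofHom ⟨f, fun g => by
    conv_lhs => rw [← hf g]
    ext x
    simp [conj]⟩

@[simp]
lemma homOfConj_hom {X X' : Rep.{u} k G} (f : X →ₗ[k] X') (hf : ∀ g, conj X X' g f = f) :
    (homOfConj f hf).hom.toLinearMap = f := rfl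

lemma conj_res_hom {φ : H →* G} {K : Subgroup G} (hK : φ.range = K) {X X' : Rep.{u} k G}
    (f : Rep.res φ X ⟶ Rep.res φ X') (g : G) (hg : g ∈ K) :
    conj X X' g f.hom.toLinearMap = f.hom.toLinearMap := by
  subst hK
  obtain ⟨h, rfl⟩ := hg
  have := conj_hom h f
  ext x
  simpa [conj] using LinearMap.congr_fun this x

/-- The vector `g⁻¹ ⊗ v` of the module induced from `N` along `φ`. The inverse agrees with the
convention of `Representation.ind`, where `x` maps `indMk g v` to `indMk (g * x⁻¹) v`. -/
def indMk (φ : H →* G) (N : Rep.{u} k H) (g : G) : N →ₗ[k] Rep.ind φ N :=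
  Representation.IndV.mk φ N.ρ g

lemma ind_indMk (φ : H →* G) (N : Rep.{u} k H) (x g : G) (v : N) :
    (Rep.ind φ N).ρ x (indMk φ N g v) = indMk φ N (g * x⁻¹) v :=
  Representation.ind_mk φ N.ρ x g v

lemma indMk_map_mul (φ : H →* G) (N : Rep.{u} k H) (h : H) (g : G) (v : N) :
    indMk φ N (φ h * g) (N.ρ h v) = indMk φ N g v := by
  have := Representation.Coinvariants.mk_self_apply
    (Representation.tprod ((Representation.leftRegular k G).comp φ) N.ρ) h
    (TensorProduct.mk k _ _ (MonoidAlgebra.single g 1) v)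
  simpa [indMk] using this

lemma ind_linearMap_ext (φ : H →* G) (N : Rep.{u} k H) {W : Type*} [AddCommGroup W] [Module k W]
    {f f' : Rep.ind φ N →ₗ[k] W} (h : ∀ g v, f (indMk φ N g v) = f' (indMk φ N g v)) : f = f' :=
  Representation.IndV.hom_ext _ _ fun g => LinearMap.ext (h g)

/-- The vector `g ⊗ g⁻¹ v` of the induced module, as a linear function of `v`. It depends only on
the coset of `g`. -/
def indTensor (φ : H →* G) (M : Rep.{u} k G) (g : G) :
    M →ₗ[k] Rep.ind φ (Rep.res φ M) :=
  indMk φ (Rep.res φ M) g⁻¹ ∘ₗ M.ρ g⁻¹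

lemma indTensor_mul_map (φ : H →* G) (M : Rep.{u} k G) (g : G) (h : H) :
    indTensor φ M (g * φ h) = indTensor φ M g := by
  ext v
  have := indMk_map_mul φ (Rep.res φ M) h⁻¹ g⁻¹ (M.ρ g⁻¹ v)
  simpa [indTensor] using this

lemma ind_indTensor (φ : H →* G) (M : Rep.{u} k G) (g g' : G) (v : M) :
    (Rep.ind φ (Rep.res φ M)).ρ g (indTensor φ M g' v) = indTensor φ M (g * g') (M.ρ g v) := by
  have := ind_indMk φ (Rep.res φ M) g g'⁻¹ (M.ρ g'⁻¹ v)
  simpa [indTensor, -Representation.ind_apply] using this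

/-- Higman's criterion: if the identity of `M` is the sum of an equivariant family of endomorphisms
indexed by a transitive `G`-set with point stabilizer contained in the image of `φ`, then `M` is a
summand of the module induced from its restriction along `φ`. -/
theorem isSummand_ind_res_of_sum (φ : H →* G) {Ω : Type*} [MulAction G Ω] (M : Rep.{u} k G)
    (f : Ω → M →ₗ[k] M) (hf : ∀ (g : G) (ω : Ω), f (g • ω) = conj M M g (f ω)) (ω₀ : Ω)
    (hstab : MulAction.stabilizer G ω₀ ≤ φ.range) (S : Finset Ω)
    (hS : ∀ ω, ω ∈ S ↔ ω ∈ MulAction.orbit G ω₀) (hsum : ∑ ω ∈ S, f ω = LinearMap.id) :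
    IsSummand M (Rep.ind φ (Rep.res φ M)) := by
  classical
  -- a section of the counit, sending `m` to the sum over `ω = g • ω₀` of `g ⊗ g⁻¹ f ω m`
  let rep : Ω → G := fun ω => if h : ω ∈ MulAction.orbit G ω₀ then h.choose else 1
  have hrep : ∀ ω ∈ S, rep ω • ω₀ = ω := fun ω hω => by
    have h := (hS ω).1 hω
    simp only [rep, dif_pos h]
    exact h.choose_spec
  have hten : ∀ g g' : G, g • ω₀ = g' • ω₀ → indTensor φ M g = indTensor φ M g' := by
    intro g g' h
    obtain ⟨x, hx⟩ := hstab (show g'⁻¹ * g ∈ MulAction.stabilizer G ω₀ by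
      rw [MulAction.mem_stabilizer_iff, mul_smul, h, inv_smul_smul])
    rw [show g = g' * φ x by rw [hx]; group, indTensor_mul_map]
  let σ : M →ₗ[k] Rep.ind φ (Rep.res φ M) := ∑ ω ∈ S, indTensor φ M (rep ω) ∘ₗ f ω
  have hσ : ∀ g, σ ∘ₗ M.ρ g = (Rep.ind φ (Rep.res φ M)).ρ g ∘ₗ σ := by
    intro g
    ext m
    simp only [σ, LinearMap.comp_apply, LinearMap.sum_apply, map_sum]
    symm
    refine Finset.sum_bij' (fun ω _ => g • ω) (fun ω _ => g⁻¹ • ω) ?_ ?_ ?_ ?_ ?_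
    · intro ω hω
      rw [hS] at hω ⊢
      exact MulAction.mem_orbit_of_mem_orbit g hω
    · intro ω hω
      rw [hS] at hω ⊢
      exact MulAction.mem_orbit_of_mem_orbit _ hω
    · intro ω _; simp
    · intro ω _; simp
    · intro ω hω
      have hω' : g • ω ∈ S := by
        rw [hS] at hω ⊢
        exact MulAction.mem_orbit_of_mem_orbit g hω
      rw [hten (rep (g • ω)) (g * rep ω) (by rw [hrep _ hω', mul_smul, hrep _ hω]), hf]
      refine (ind_indTensor φ M g (rep ω) (f ω m)).trans ?_
      simp [conj]
  refine ⟨⟨Rep.ofHom ⟨σ, hσ⟩, (Rep.indResHomEquiv φ (Rep.res φ M) M).symm (𝟙 _), ?_⟩⟩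
  ext m
  have := LinearMap.congr_fun hsum m
  simp only [LinearMap.sum_apply, LinearMap.id_apply] at this
  conv_rhs => rw [show (𝟙 M : M ⟶ M).hom.toLinearMap m = m from rfl, ← this]
  change (Rep.Hom.hom ((Rep.indResHomEquiv φ (Rep.res φ M) M).symm (𝟙 _))).toLinearMap (σ m) = _
  simp only [σ, LinearMap.sum_apply, map_sum]
  refine Finset.sum_congr rfl fun ω _ => ?_
  simp [indTensor, indMk, Rep.indResHomEquiv]

/-- The projection of the induced module onto the summand `1 ⊗ N`. -/
lemma exists_ind_proj (φ : H →* G) (hφ : Function.Injective φ) (N : Rep.{u} k H) :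
    ∃ ε : Rep.res φ (Rep.ind φ N) ⟶ N,
      (∀ h v, ε.hom (indMk φ N (φ h) v) = N.ρ h⁻¹ v) ∧
      ∀ g v, g ∉ φ.range → ε.hom (indMk φ N g v) = 0 := by
  classical
  let c : G → N →ₗ[k] N := fun g => if h : g ∈ φ.range then N.ρ h.choose⁻¹ else 0
  have hc1 : ∀ h, c (φ h) = N.ρ h⁻¹ := by
    intro h
    have hm : φ h ∈ φ.range := ⟨h, rfl⟩
    simp only [c, dif_pos hm]
    rw [hφ hm.choose_spec]
  have hc2 : ∀ g, g ∉ φ.range → c g = 0 := fun g hg => by simp only [c, dif_neg hg]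
  have hcm : ∀ h g, c (φ h * g) = c g ∘ₗ N.ρ h⁻¹ := by
    intro h g
    by_cases hg : g ∈ φ.range
    · obtain ⟨y, rfl⟩ := hg
      rw [← map_mul, hc1, hc1, mul_inv_rev, map_mul]; rfl
    · rw [hc2 g hg, hc2, LinearMap.zero_comp]
      rwa [Subgroup.mul_mem_cancel_left _ (MonoidHom.mem_range.2 ⟨h, rfl⟩)]
  have hcm' : ∀ h g, c (g * φ h) = N.ρ h⁻¹ ∘ₗ c g := by
    intro h g
    by_cases hg : g ∈ φ.range
    · obtain ⟨y, rfl⟩ := hg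
      rw [← map_mul, hc1, hc1, mul_inv_rev, map_mul]; rfl
    · rw [hc2 g hg, hc2, LinearMap.comp_zero]
      rwa [Subgroup.mul_mem_cancel_right _ (MonoidHom.mem_range.2 ⟨h, rfl⟩)]
  let e : Rep.ind φ N →ₗ[k] N := Representation.Coinvariants.lift _
    (TensorProduct.lift <| (Finsupp.lift _ _ _ c) ∘ₗ
      (MonoidAlgebra.coeffLinearEquiv k).toLinearMap) fun h => by
      ext g x
      simp [hcm]
  have he : ∀ g v, e (indMk φ N g v) = c g v := by
    intro g v
    simp [e, indMk]
  refine ⟨Rep.ofHom ⟨e, fun h => ?_⟩, fun h v => ?_, fun g v hg => ?_⟩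
  · refine ind_linearMap_ext φ N fun g v => ?_
    change e ((Rep.ind φ N).ρ (φ h) (indMk φ N g v)) = N.ρ h (e (indMk φ N g v))
    rw [ind_indMk, he, he, ← map_inv, hcm', inv_inv, LinearMap.comp_apply]
  · exact (he _ _).trans (by rw [hc1])
  · exact (he _ _).trans (by rw [hc2 g hg, LinearMap.zero_apply])

/-- Higman's criterion: the identity of a summand of a module induced from `N` is a relative trace
of an endomorphism factoring through `N`. -/
theorem exists_sum_of_isSummand_ind (φ : H →* G) (hφ : Function.Injective φ)
    {K : Subgroup G} (hK : φ.range = K) [Fintype (G ⧸ K)] {M : Rep.{u} k G} {N : Rep.{u} k H}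
    (h : IsSummand M (Rep.ind φ N)) :
    ∃ (b : Rep.res φ M ⟶ N) (a : N ⟶ Rep.res φ M),
      ∑ q : G ⧸ K, conj M M q.out (b ≫ a).hom.toLinearMap = LinearMap.id := by
  classical
  obtain ⟨⟨i, r, hir⟩⟩ := h
  obtain ⟨ε, hε1, hε2⟩ := exists_ind_proj φ hφ N
  let E := Rep.ind φ N
  let η : N ⟶ Rep.res φ E := Rep.indResHomEquiv φ N E (𝟙 _)
  have hη : ∀ v, η.hom v = indMk φ N 1 v := fun v => rfl
  have key : ∑ q : G ⧸ K, conj E E q.out (ε ≫ η).hom.toLinearMap = LinearMap.id := by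
    refine ind_linearMap_ext φ N fun g v => ?_
    simp only [LinearMap.sum_apply, LinearMap.id_apply]
    have hterm : ∀ x : G, conj E E x (ε ≫ η).hom.toLinearMap (indMk φ N g v) =
        E.ρ x (η.hom (ε.hom (indMk φ N (g * x) v))) := by
      intro x
      have h1 : E.ρ x⁻¹ (indMk φ N g v) =
          indMk φ N (g * x) v := by
        rw [ind_indMk, inv_inv]
      rw [← h1]
      rfl
    rw [Finset.sum_eq_single (QuotientGroup.mk g⁻¹ : G ⧸ K)]
    · rw [conj_out (conj_res_hom hK (ε ≫ η)), hterm, mul_inv_cancel, ← map_one φ, hε1, hη,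
        inv_one, map_one, Module.End.one_apply, ind_indMk, inv_inv, one_mul]
    · intro q _ hq
      rw [hterm, hε2, map_zero, map_zero]
      intro hgq
      refine hq ?_
      rw [← q.out_eq']
      refine QuotientGroup.eq.2 ?_
      rw [hK] at hgq
      rw [← inv_mem_iff]
      simpa using hgq
    · simp
  refine ⟨(Rep.resFunctor φ).map i ≫ ε, η ≫ (Rep.resFunctor φ).map r, ?_⟩
  have hrw : ∀ x : G, conj M M x
      (((Rep.resFunctor φ).map i ≫ ε) ≫ η ≫ (Rep.resFunctor φ).map r).hom.toLinearMap =
      r.hom.toLinearMap ∘ₗ conj E E x (ε ≫ η).hom.toLinearMap ∘ₗ i.hom.toLinearMap := by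
    intro x
    calc _ = conj M M x (r.hom.toLinearMap ∘ₗ (ε ≫ η).hom.toLinearMap ∘ₗ i.hom.toLinearMap) := rfl
      _ = _ := by rw [conj_comp (X' := E), conj_comp (X' := E), conj_hom, conj_hom]
  have hsum : ∑ q : G ⧸ K, conj M M q.out
      (((Rep.resFunctor φ).map i ≫ ε) ≫ η ≫ (Rep.resFunctor φ).map r).hom.toLinearMap =
      r.hom.toLinearMap ∘ₗ (∑ q : G ⧸ K, conj E E q.out (ε ≫ η).hom.toLinearMap) ∘ₗ
        i.hom.toLinearMap := by
    ext m
    simp only [hrw, LinearMap.sum_apply, LinearMap.comp_apply, map_sum]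
  rw [hsum, key]
  ext m
  exact LinearMap.congr_fun (congrArg (fun t => t.hom.toLinearMap) hir) m

end RelativeTrace

/-! ### Transitivity of induction -/

section Induction

variable {k : Type u} [Field k] {G H K : Type u} [Group G] [Group H] [Group K]

lemma IsSummand.trans {X Y Z : Rep.{u} k G} (h : IsSummand X Y) (h' : IsSummand Y Z) :
    IsSummand X Z :=
  ⟨h.some.trans h'.some⟩

/-- Induction in stages. -/
def indCompIso (φ : H →* G) (ψ : K →* H) (N : Rep.{u} k K) :
    Rep.ind φ (Rep.ind ψ N) ≅ Rep.ind (φ.comp ψ) N :=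
  (((Rep.indResAdjunction k ψ).comp (Rep.indResAdjunction k φ)).leftAdjointUniq
    (Rep.indResAdjunction k (φ.comp ψ))).app N

lemma IsSummand.ind_trans {φ : H →* G} {ψ : K →* H} {M : Rep.{u} k G} {W : Rep.{u} k H}
    {N : Rep.{u} k K} (h : IsSummand M (Rep.ind φ W)) (h' : IsSummand W (Rep.ind ψ N)) :
    IsSummand M (Rep.ind (φ.comp ψ) N) :=
  h.trans ⟨(h'.some.map (Rep.indFunctor k φ)).trans (Retract.ofIso (indCompIso φ ψ N))⟩

lemma IsSummand.isRelProjective {ψ : K →* G} {N : Rep.{u} k K} {M : Rep.{u} k G}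
    (h : IsSummand M (Rep.ind ψ N)) {Q : Subgroup G} (hQ : ψ.range ≤ Q) : IsRelProjective Q M := by
  let ψ' : K →* Q := ψ.codRestrict Q fun x => hQ ⟨x, rfl⟩
  exact ⟨Rep.ind ψ' N, h.trans ⟨Retract.ofIso (indCompIso Q.subtype ψ' N).symm⟩⟩

end Induction

/-! ### Endomorphisms of indecomposable modules -/

section LocalEnd

variable {k : Type u} [Field k] {G : Type u} [Group G]

lemma id_notMem_nonSplit {M : Rep.{u} k G} [Module.Finite k M] (hM : Indecomposable M) :
    𝟙 M ∉ nonSplit M M := fun h =>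
  (mem_nonSplit_iff hM _).1 h inferInstance

lemma isIso_of_isSplitMono {M : Rep.{u} k G} [Module.Finite k M] (hM : Indecomposable M)
    (f : M ⟶ M) (hf : IsSplitMono f) : IsIso f := by
  rcases nilpotent_or_unit hM (End.of f) with ⟨n, hn⟩ | h
  · exfalso
    refine hM.1 ((IsZero.iff_id_eq_zero M).2 ?_)
    have : ∀ n : ℕ, (End.of f) ^ n = 0 → 𝟙 M = 0 := by
      intro n
      induction n with
      | zero => exact fun h => h
      | succ n ih =>
        intro h
        refine ih ?_
        have h' : End.of f * (End.of f) ^ n = 0 := by rw [← pow_succ']; exact h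
        have h'' : ((End.of f) ^ n : M ⟶ M) ≫ f = 0 := h'
        exact zero_of_comp_mono f h''
    exact this n hn
  · exact (isUnit_iff_isIso _).1 h

/-- If a sum of endomorphisms of a finite dimensional indecomposable module is the identity, then
one of the summands is invertible. -/
lemma exists_isIso_of_sum_eq_id {M : Rep.{u} k G} [Module.Finite k M] (hM : Indecomposable M)
    {ι : Type*} (s : Finset ι) (f : ι → (M ⟶ M)) (h : ∑ i ∈ s, f i = 𝟙 M) :
    ∃ i ∈ s, IsIso (f i) := by
  by_contra! hcon
  refine id_notMem_nonSplit hM (h ▸ Submodule.sum_mem _ fun i hi => ?_)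
  exact (mem_nonSplit_iff hM _).2 fun hs => hcon i hi (isIso_of_isSplitMono hM _ hs)

lemma isIso_of_bijective {X Y : Rep.{u} k G} (f : X ⟶ Y) (hf : Function.Bijective f.hom) :
    IsIso f := by
  have : IsIso ((forget (Rep.{u} k G)).map f) := (isIso_iff_bijective _).2 hf
  exact isIso_of_reflects_iso f (forget (Rep.{u} k G))

lemma bijective_of_isIso {X Y : Rep.{u} k G} (f : X ⟶ Y) [IsIso f] :
    Function.Bijective f.hom :=
  (isIso_iff_bijective ((forget (Rep.{u} k G)).map f)).1 inferInstance

end LocalEnd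

/-! ### Sums over the orbits of a vertex -/

section Mackey

variable {k : Type u} [Field k] {G : Type u} [Group G] [Finite G]

/-- Let `W` be an indecomposable module for the vertex `P` of `M` such that `M` is a summand of the
module induced from `W`. If the identity of `W` is a sum of composites of fixed maps with the
conjugates `x θ x⁻¹` of a `P`-equivariant map, over a `P`-stable set of cosets `xP`, then one of
the terms with `x` normalizing `P` is bijective. -/
theorem exists_normalizing_coset {M : Rep.{u} k G} {P : Subgroup G} (hP : IsVertex P M)
    {W : Rep.{u} k P} [Module.Finite k W] (hW : Indecomposable W) (hMW : IsSummand M (induced W))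
    {X X' : Rep.{u} k G} (t : W ⟶ Rep.res P.subtype X) (s : Rep.res P.subtype X' ⟶ W)
    (θ : X →ₗ[k] X') (hθ : ∀ g ∈ P, conj X X' g θ = θ) (S : Finset (G ⧸ P))
    (hS : ∀ g ∈ P, ∀ q ∈ S, g • q ∈ S)
    (hsum : ∑ q ∈ S, s.hom.toLinearMap ∘ₗ conj X X' q.out θ ∘ₗ t.hom.toLinearMap =
      LinearMap.id) :
    ∃ x ∈ Subgroup.normalizer (P : Set G), (QuotientGroup.mk x : G ⧸ P) ∈ S ∧
      Function.Bijective (s.hom.toLinearMap ∘ₗ conj X X' x θ ∘ₗ t.hom.toLinearMap) := by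
  classical
  let f : G ⧸ P → W →ₗ[k] W := fun q =>
    s.hom.toLinearMap ∘ₗ conj X X' q.out θ ∘ₗ t.hom.toLinearMap
  have hf : ∀ (g : P) q, f (g • q) = conj W W g (f q) := by
    intro g q
    have h1 : conj X X' (g • q).out θ = conj X X' g (conj X X' q.out θ) :=
      conj_out_smul hθ (g : G) q
    ext v
    have h2 := Rep.hom_comm_apply t g⁻¹ v
    have h3 := fun z => Rep.hom_comm_apply s g z
    simp only [f, h1]
    change s.hom (X'.ρ g (conj X X' q.out θ (X.ρ (g : G)⁻¹ (t.hom v)))) =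
      W.ρ g (s.hom (conj X X' q.out θ (t.hom (W.ρ g⁻¹ v))))
    rw [h2, ← h3]
    rfl
  let π : G ⧸ P → MulAction.orbitRel.Quotient P (G ⧸ P) := Quotient.mk _
  have hπ : ∀ q q', π q = π q' ↔ q ∈ MulAction.orbit P q' := fun q q' => Quotient.eq
  have hπs : ∀ (g : P) q, π (g • q) = π q := fun g q =>
    (hπ _ _).2 (MulAction.mem_orbit _ _)
  -- the partial sums over the `P`-orbits are endomorphisms of `W`
  have hsumconj : ∀ o, ∀ g, conj W W g (∑ q ∈ S with π q = o, f q) =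
      ∑ q ∈ S with π q = o, f q := by
    intro o g
    simp only [map_sum]
    refine Finset.sum_bij' (fun q _ => g • q) (fun q _ => g⁻¹ • q) ?_ ?_ ?_ ?_ ?_
    · intro q hq
      rw [Finset.mem_filter] at hq ⊢
      exact ⟨hS g g.2 q hq.1, (hπs g q).trans hq.2⟩
    · intro q hq
      rw [Finset.mem_filter] at hq ⊢
      exact ⟨hS _ (g⁻¹).2 q hq.1, (hπs _ q).trans hq.2⟩
    · intro q _; simp
    · intro q _; simp
    · intro q _; exact (hf g q).symm
  obtain ⟨o, ho, hiso⟩ := exists_isIso_of_sum_eq_id hW (S.image π)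
    (fun o => homOfConj (∑ q ∈ S with π q = o, f q) (hsumconj o)) (by
      ext v
      have h := Finset.sum_fiberwise_of_maps_to
        (fun q hq => Finset.mem_image_of_mem π hq) f (s := S)
      rw [Rep.sum_hom, Representation.IntertwiningMap.toLinearMap_sum]
      simp only [homOfConj_hom]
      rw [h]
      exact LinearMap.congr_fun hsum v)
  obtain ⟨q₀, hq₀, rfl⟩ := Finset.mem_image.1 ho
  set e := homOfConj (∑ q ∈ S with π q = π q₀, f q) (hsumconj (π q₀)) with he
  have hmem : ∀ q, q ∈ S.filter (fun q => π q = π q₀) ↔ q ∈ MulAction.orbit P q₀ := by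
    intro q
    rw [Finset.mem_filter, hπ]
    refine ⟨fun h => h.2, fun h => ⟨?_, h⟩⟩
    obtain ⟨g, rfl⟩ := h
    exact hS g g.2 q₀ hq₀
  -- by Higman's criterion `W` is projective relative to the stabilizer of `q₀`
  have hWQ : IsSummand W (Rep.ind (MulAction.stabilizer P q₀).subtype
      (Rep.res (MulAction.stabilizer P q₀).subtype W)) := by
    refine isSummand_ind_res_of_sum _ W (fun q => (inv e).hom.toLinearMap ∘ₗ f q) ?_ q₀
      (by rw [Subgroup.range_subtype]) (S.filter fun q => π q = π q₀) hmem ?_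
    · intro g q
      rw [hf, conj_comp (X' := W), conj_hom]
    · ext v
      have h1 : (e ≫ inv e).hom.toLinearMap v = v := by rw [IsIso.hom_inv_id]; rfl
      have h2 : e.hom.toLinearMap v = ∑ q ∈ S with π q = π q₀, f q v := by
        rw [he, homOfConj_hom, LinearMap.sum_apply]
      rw [Rep.hom_comp_toLinearMap, LinearMap.comp_apply, h2, map_sum] at h1
      simpa only [LinearMap.sum_apply, LinearMap.comp_apply, LinearMap.id_apply] using h1
  have hrel : IsRelProjective ((MulAction.stabilizer P q₀).map P.subtype) M :=
    (hMW.ind_trans hWQ).isRelProjective (by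
      rw [MonoidHom.range_comp, Subgroup.range_subtype])
  have hle : P ≤ (MulAction.stabilizer P q₀).map P.subtype :=
    hP.2 hrel (Subgroup.map_subtype_le _)
  have hfix : ∀ g : P, g • q₀ = q₀ := by
    intro g
    obtain ⟨y, hy, hyg⟩ := hle g.2
    have : y = g := Subtype.ext hyg
    rwa [this] at hy
  obtain ⟨x, rfl⟩ := QuotientGroup.mk_surjective q₀
  refine ⟨x, ?_, hq₀, ?_⟩
  · rw [← inv_mem_iff]
    refine Subgroup.mem_normalizer_fintype fun g hg => ?_
    have h := hfix ⟨g, hg⟩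
    have h' : (QuotientGroup.mk (g * x) : G ⧸ P) = QuotientGroup.mk x := h
    have := QuotientGroup.eq.1 h'.symm
    simpa [mul_assoc] using this
  · have hsing : S.filter (fun q => π q = π (QuotientGroup.mk x)) = {QuotientGroup.mk x} := by
      ext q
      rw [hmem, Finset.mem_singleton]
      constructor
      · rintro ⟨g, rfl⟩
        exact hfix g
      · rintro rfl
        exact MulAction.mem_orbit_self _
    have hbij := bijective_of_isIso e
    have h1 : e.hom.toLinearMap = f (QuotientGroup.mk x) := by
      rw [he, homOfConj_hom, hsing, Finset.sum_singleton]
    have h2 : f (QuotientGroup.mk x) =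
        s.hom.toLinearMap ∘ₗ conj X X' x θ ∘ₗ t.hom.toLinearMap := by
      simp only [f]
      rw [conj_out hθ]
    rw [← h2, ← h1]
    exact hbij

end Mackey

/-! ### A source is a summand of the restriction -/

section Source

variable {k : Type u} [Field k] {G : Type u} [Group G]

lemma finrank_le_of_isSummand {V W : Rep.{u} k G} [Module.Finite k W] (h : IsSummand V W) :
    Module.finrank k V ≤ Module.finrank k W := by
  obtain ⟨⟨i, r, hir⟩⟩ := h
  refine LinearMap.finrank_le_finrank_of_injective (f := i.hom.toLinearMap) ?_
  refine Function.LeftInverse.injective (g := r.hom) fun v => ?_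
  exact LinearMap.congr_fun (congrArg (fun t => t.hom.toLinearMap) hir) v

lemma finite_of_isSummand {V W : Rep.{u} k G} [Module.Finite k W] (h : IsSummand V W) :
    Module.Finite k V := by
  obtain ⟨⟨i, r, hir⟩⟩ := h
  refine Module.Finite.of_injective i.hom.toLinearMap ?_
  refine Function.LeftInverse.injective (g := r.hom) fun v => ?_
  exact LinearMap.congr_fun (congrArg (fun t => t.hom.toLinearMap) hir) v

/-- A summand of full dimension is the whole module. -/
lemma isIso_of_finrank_le {V W : Rep.{u} k G} [Module.Finite k W] (h : Retract V W)
    (hd : Module.finrank k W ≤ Module.finrank k V) : IsIso h.i := by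
  have := finite_of_isSummand ⟨h⟩
  have hinj : Function.Injective h.i.hom.toLinearMap :=
    Function.LeftInverse.injective (g := h.r.hom) fun v =>
      LinearMap.congr_fun (congrArg (fun t => t.hom.toLinearMap) h.retract) v
  refine isIso_of_bijective _ ⟨hinj, ?_⟩
  exact (LinearMap.injective_iff_surjective_of_finrank_eq_finrank
    (le_antisymm (finrank_le_of_isSummand ⟨h⟩) hd)).1 hinj

/-- An indecomposable summand of a module induced from a direct sum is a summand of a module induced
from one of the two terms. -/
lemma isSummand_ind_biprod {H : Type u} [Group H] {M : Rep.{u} k G} [Module.Finite k M]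
    (hM : Indecomposable M) (φ : H →* G) {V A B : Rep.{u} k H} (e : V ≅ A ⊞ B)
    (h : IsSummand M (Rep.ind φ V)) : IsSummand M (Rep.ind φ A) ∨ IsSummand M (Rep.ind φ B) := by
  obtain ⟨⟨i, r, hir⟩⟩ := h
  have hV : (e.hom ≫ biprod.fst) ≫ biprod.inl ≫ e.inv +
      (e.hom ≫ biprod.snd) ≫ biprod.inr ≫ e.inv = 𝟙 V := by
    have := congrArg (fun t => e.hom ≫ t ≫ e.inv) (biprod.total (X := A) (Y := B))
    simpa [-biprod.total, Preadditive.comp_add, Preadditive.add_comp] using this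
  let F := Rep.indFunctor k φ
  have : F.Additive := (Rep.indResAdjunction k φ).left_adjoint_additive
  have hF : F.map (e.hom ≫ biprod.fst) ≫ F.map (biprod.inl ≫ e.inv) +
      F.map (e.hom ≫ biprod.snd) ≫ F.map (biprod.inr ≫ e.inv) = 𝟙 (F.obj V) := by
    rw [← F.map_comp, ← F.map_comp, ← F.map_add, hV, F.map_id]
  have hsplit : ∀ {Z : Rep.{u} k G} (a : M ⟶ Z) (b : Z ⟶ M), IsIso (a ≫ b) → IsSummand M Z :=
    fun a b _ => ⟨⟨a, b ≫ inv (a ≫ b), by rw [← Category.assoc, IsIso.hom_inv_id]⟩⟩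
  obtain ⟨c, -, hc⟩ := exists_isIso_of_sum_eq_id hM (Finset.univ : Finset Bool)
    (fun c => bif c then (i ≫ F.map (e.hom ≫ biprod.fst)) ≫ F.map (biprod.inl ≫ e.inv) ≫ r
      else (i ≫ F.map (e.hom ≫ biprod.snd)) ≫ F.map (biprod.inr ≫ e.inv) ≫ r) (by
    rw [Fintype.sum_bool, cond_true, cond_false, ← hir, ← Category.id_comp r]
    change _ = i ≫ 𝟙 (F.obj V) ≫ r
    rw [← hF]
    simp only [Category.id_comp, Category.assoc, Preadditive.add_comp, Preadditive.comp_add])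
  cases c
  · exact Or.inr (hsplit _ _ hc)
  · exact Or.inl (hsplit _ _ hc)

/-- If `M` is relatively `P`-projective, then `M` is a summand of a module induced from an
indecomposable summand of its restriction to `P`. -/
lemma exists_indecomposable_summand_res [Finite G] {M : Rep.{u} k G} [Module.Finite k M]
    (hM : Indecomposable M) {P : Subgroup G} {U : Rep.{u} k P} (hMU : IsSummand M (induced U)) :
    ∃ V : Rep.{u} k P, Module.Finite k V ∧ Indecomposable V ∧
      IsSummand V (Rep.res P.subtype M) ∧ IsSummand M (induced V) := by
  classical
  have := Fintype.ofFinite (G ⧸ P)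
  have hfin : Module.Finite k (Rep.res P.subtype M) := inferInstanceAs (Module.Finite k M)
  have h0 : IsSummand M (induced (Rep.res P.subtype M)) := by
    obtain ⟨b, a, hab⟩ := exists_sum_of_isSummand_ind P.subtype P.subtype_injective
      P.range_subtype hMU
    have hfix := conj_res_hom P.range_subtype (b ≫ a)
    refine isSummand_ind_res_of_sum P.subtype M
      (fun q : G ⧸ P => conj M M q.out (b ≫ a).hom.toLinearMap)
      (fun g q => conj_out_smul hfix g q) (QuotientGroup.mk 1) ?_ Finset.univ ?_ hab
    · intro g hg
      have hg' : (QuotientGroup.mk (g * 1) : G ⧸ P) = QuotientGroup.mk 1 := hg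
      have := QuotientGroup.eq.1 hg'.symm
      rw [P.range_subtype]
      simpa using this
    · intro q
      simp [MulAction.orbit_eq_univ]
  -- a summand of minimal dimension from which `M` is induced up to summands is indecomposable
  let C := {n : ℕ | ∃ V : Rep.{u} k P, IsSummand V (Rep.res P.subtype M) ∧
    IsSummand M (induced V) ∧ Module.finrank k V = n}
  have hC : C.Nonempty := ⟨_, _, ⟨Retract.refl _⟩, h0, rfl⟩
  obtain ⟨V, hV1, hV2, hVd⟩ := Nat.sInf_mem hC
  have hmin : ∀ V', IsSummand V' (Rep.res P.subtype M) → IsSummand M (induced V') →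
      Module.finrank k V ≤ Module.finrank k V' := fun V' h1 h2 =>
    hVd ▸ Nat.sInf_le ⟨V', h1, h2, rfl⟩
  have hVfin := finite_of_isSummand hV1
  refine ⟨V, hVfin, ⟨fun hz => ?_, fun A B e => ?_⟩, hV1, hV2⟩
  · refine hM.1 ((IsZero.iff_id_eq_zero M).2 ?_)
    obtain ⟨⟨i, r, hir⟩⟩ := hV2
    have : (Rep.indFunctor k P.subtype).Additive :=
      (Rep.indResAdjunction k P.subtype).left_adjoint_additive
    have hz' : IsZero (induced V) := (Rep.indFunctor k P.subtype).map_isZero hz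
    rw [← hir, hz'.eq_of_tgt i 0, zero_comp]
  · rcases isSummand_ind_biprod hM P.subtype e hV2 with h | h
    · right
      let hr : Retract A V := ⟨biprod.inl ≫ e.inv, e.hom ≫ biprod.fst, by simp⟩
      have : IsIso (biprod.inl ≫ e.inv) :=
        isIso_of_finrank_le hr (hmin A (IsSummand.trans ⟨hr⟩ hV1) h)
      refine (IsZero.iff_id_eq_zero B).2 ?_
      have h0 : e.hom ≫ biprod.snd = 0 := by
        rw [← cancel_epi (biprod.inl ≫ e.inv)]; simp
      calc 𝟙 B = (biprod.inr ≫ e.inv) ≫ e.hom ≫ biprod.snd := by simp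
        _ = 0 := by rw [h0, comp_zero]
    · left
      let hr : Retract B V := ⟨biprod.inr ≫ e.inv, e.hom ≫ biprod.snd, by simp⟩
      have : IsIso (biprod.inr ≫ e.inv) :=
        isIso_of_finrank_le hr (hmin B (IsSummand.trans ⟨hr⟩ hV1) h)
      refine (IsZero.iff_id_eq_zero A).2 ?_
      have h0 : e.hom ≫ biprod.fst = 0 := by
        rw [← cancel_epi (biprod.inr ≫ e.inv)]; simp
      calc 𝟙 A = (biprod.inl ≫ e.inv) ≫ e.hom ≫ biprod.fst := by simp
        _ = 0 := by rw [h0, comp_zero]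

/-- Conjugation by an element of the normalizer of `P`, on `P`-equivariant maps between
`G`-modules. -/
def conjHom {P : Subgroup G} {x : G} (hx : x ∈ Subgroup.normalizer (P : Set G))
    {X X' : Rep.{u} k G} (f : Rep.res P.subtype X ⟶ Rep.res P.subtype X') :
    Rep.res P.subtype X ⟶ Rep.res P.subtype X' :=
  homOfConj (conj X X' x f.hom.toLinearMap) fun g => by
    have hg : x⁻¹ * g * x ∈ P := by
      have := (Subgroup.mem_normalizer_iff.1 (inv_mem hx) g).1 g.2
      simpa using this
    change conj X X' (g : G) (conj X X' x _) = _
    rw [← conj_mul, show (g : G) * x = x * (x⁻¹ * g * x) by group, conj_mul,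
      conj_res_hom P.range_subtype f _ hg]

lemma conjHom_comp {P : Subgroup G} {x : G} (hx : x ∈ Subgroup.normalizer (P : Set G))
    {X X' X'' : Rep.{u} k G} (f : Rep.res P.subtype X ⟶ Rep.res P.subtype X')
    (f' : Rep.res P.subtype X' ⟶ Rep.res P.subtype X'') :
    conjHom hx (f ≫ f') = conjHom hx f ≫ conjHom hx f' := by
  ext v
  exact LinearMap.congr_fun (conj_comp x f.hom.toLinearMap f'.hom.toLinearMap) v

lemma conjHom_inv_conjHom {P : Subgroup G} {x : G} (hx : x ∈ Subgroup.normalizer (P : Set G))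
    {X X' : Rep.{u} k G} (f : Rep.res P.subtype X ⟶ Rep.res P.subtype X') :
    conjHom (inv_mem hx) (conjHom hx f) = f := by
  ext v
  have := LinearMap.congr_fun (conj_mul X X' x⁻¹ x f.hom.toLinearMap) v
  rw [inv_mul_cancel, conj, map_one] at this
  exact this.symm

lemma conjHom_conjHom_inv {P : Subgroup G} {x : G} (hx : x ∈ Subgroup.normalizer (P : Set G))
    {X X' : Rep.{u} k G} (f : Rep.res P.subtype X ⟶ Rep.res P.subtype X') :
    conjHom hx (conjHom (inv_mem hx) f) = f := by
  ext v
  have := LinearMap.congr_fun (conj_mul X X' x x⁻¹ f.hom.toLinearMap) v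
  rw [mul_inv_cancel, conj, map_one] at this
  exact this.symm

lemma conjHom_zero {P : Subgroup G} {x : G} (hx : x ∈ Subgroup.normalizer (P : Set G))
    {X X' : Rep.{u} k G} :
    conjHom hx (0 : Rep.res P.subtype X ⟶ Rep.res P.subtype X') = 0 := by
  ext v
  exact LinearMap.congr_fun (map_zero (X.ρ.linHom X'.ρ x)) v

/-- A source of `M` is a summand of the restriction of `M` to the vertex. For an indecomposable
summand `V` of the restriction such that `M` is a summand of the module induced from `V`, the
identity of `V` is a sum of conjugates of a map through `U`, so it factors up to an automorphism
through a conjugate of `U` by an element of the normalizer. -/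
theorem IsVertex.isSummand_res [Finite G] {M : Rep.{u} k G} [Module.Finite k M]
    (hM : Indecomposable M) {P : Subgroup G} (hP : IsVertex P M) {U : Rep.{u} k P}
    (hU : Indecomposable U) (hMU : IsSummand M (induced U)) :
    IsSummand U (Rep.res P.subtype M) := by
  classical
  have := Fintype.ofFinite (G ⧸ P)
  obtain ⟨V, hVfin, hV, ⟨ι, π, hιπ⟩, hMV⟩ := exists_indecomposable_summand_res hM hMU
  obtain ⟨b, a, hab⟩ := exists_sum_of_isSummand_ind P.subtype P.subtype_injective
    P.range_subtype hMU
  obtain ⟨x, hx, -, hbij⟩ := exists_normalizing_coset hP hV hMV ι π (b ≫ a).hom.toLinearMap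
    (conj_res_hom P.range_subtype (b ≫ a)) Finset.univ (fun _ _ _ _ => Finset.mem_univ _) (by
      ext v
      have h1 := LinearMap.congr_fun hab (ι.hom v)
      simp only [LinearMap.sum_apply] at h1
      simp only [LinearMap.sum_apply, LinearMap.comp_apply, ← map_sum]
      refine (congrArg π.hom h1).trans ?_
      exact LinearMap.congr_fun (congrArg (fun t => t.hom.toLinearMap) hιπ) v)
  let Θ := conjHom hx (b ≫ a)
  have hiso : IsIso (ι ≫ Θ ≫ π) := isIso_of_bijective _ hbij
  let ξ : Rep.res P.subtype M ⟶ Rep.res P.subtype M := π ≫ inv (ι ≫ Θ ≫ π) ≫ ι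
  have h1 : ξ ≫ Θ ≫ ξ = ξ := by
    have := IsIso.hom_inv_id_assoc (ι ≫ Θ ≫ π) ι
    simp only [Category.assoc] at this
    simp only [ξ, Category.assoc, this]
  have h2 : ι ≫ (Θ ≫ ξ ≫ Θ) ≫ π = ι ≫ Θ ≫ π := by
    have := IsIso.inv_hom_id (ι ≫ Θ ≫ π)
    simp only [ξ, Category.assoc, this, Category.comp_id]
  -- conjugating the idempotent `ξ ≫ Θ` back by `x` gives a nonzero idempotent of `U`
  let Ξ := conjHom (inv_mem hx) ξ
  have h3 : Ξ ≫ (b ≫ a) ≫ Ξ = Ξ := by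
    have := congrArg (conjHom (inv_mem hx)) h1
    rwa [conjHom_comp, conjHom_comp, conjHom_inv_conjHom] at this
  have hidem : (a ≫ Ξ ≫ b) ≫ (a ≫ Ξ ≫ b) = a ≫ Ξ ≫ b := by
    have := congrArg (fun t => a ≫ t ≫ b) h3
    simpa only [Category.assoc] using this
  rcases idem_eq_zero_or_one hU _ hidem with h | h
  · exfalso
    have h4 : (b ≫ a) ≫ Ξ ≫ (b ≫ a) = 0 := by
      have := congrArg (fun t => b ≫ t ≫ a) h
      simpa only [Category.assoc, zero_comp, comp_zero] using this
    have h5 : Θ ≫ ξ ≫ Θ = 0 := by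
      have := congrArg (conjHom hx) h4
      rwa [conjHom_comp, conjHom_comp, conjHom_conjHom_inv, conjHom_zero] at this
    rw [h5, zero_comp, comp_zero] at h2
    refine hV.1 ((IsZero.iff_id_eq_zero V).2 ?_)
    calc 𝟙 V = (ι ≫ Θ ≫ π) ≫ inv (ι ≫ Θ ≫ π) := (IsIso.hom_inv_id _).symm
      _ = 0 := by simp only [← h2, zero_comp]
  · exact ⟨⟨a, Ξ ≫ b, h⟩⟩

end Source

/-! ### Relative traces -/

section RelTrace

variable {k : Type u} [Field k] {G : Type u} [Group G]

/-- Transitivity of the relative trace, also for partial sums over the cosets of `I` with a given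
property. -/
lemma sum_conj_out_of_le {P I : Subgroup G} (hle : P ≤ I) [Fintype (G ⧸ P)]
    [Fintype (G ⧸ I)] [Fintype (I ⧸ P.subgroupOf I)] {X X' : Rep.{u} k G} {θ : X →ₗ[k] X'}
    (hθ : ∀ g ∈ P, conj X X' g θ = θ) (p : G ⧸ I → Prop) [DecidablePred p] :
    ∑ q : G ⧸ P with p (QuotientGroup.mk q.out), conj X X' q.out θ =
      ∑ q : G ⧸ I with p q,
        conj X X' q.out (∑ y : I ⧸ P.subgroupOf I, conj X X' (y.out : G) θ) := by
  classical
  rw [Finset.sum_filter, Finset.sum_filter,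
    ← (Subgroup.quotientEquivProdOfLE hle).symm.sum_comp, Fintype.sum_prod_type]
  refine Finset.sum_congr rfl fun q _ => ?_
  have hsymm : ∀ y : I ⧸ P.subgroupOf I, (Subgroup.quotientEquivProdOfLE hle).symm (q, y) =
      QuotientGroup.mk (q.out * y.out) := by
    intro y
    conv_lhs => rw [← y.out_eq']
    rfl
  have hmk : ∀ y : I ⧸ P.subgroupOf I,
      (QuotientGroup.mk (QuotientGroup.mk (q.out * y.out) : G ⧸ P).out : G ⧸ I) = q := by
    intro y
    obtain ⟨h, hh⟩ := QuotientGroup.mk_out_eq_mul P (q.out * y.out)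
    rw [hh]
    conv_rhs => rw [← q.out_eq']
    refine (QuotientGroup.eq.2 ?_).symm
    rw [mul_assoc, inv_mul_cancel_left]
    exact mul_mem y.out.2 (hle h.2)
  simp only [hsymm, hmk]
  split_ifs
  · simp only [map_sum]
    refine Finset.sum_congr rfl fun y _ => ?_
    rw [conj_out hθ, conj_mul]
  · simp

/-- The relative trace of an `H`-equivariant map between `G`-modules: the sum of its conjugates
over the left cosets of `H`. -/
def relTrace (H : Subgroup G) [Fintype (G ⧸ H)] {X X' : Rep.{u} k G}
    (f : Rep.res H.subtype X ⟶ Rep.res H.subtype X') : X ⟶ X' :=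
  homOfConj (∑ q : G ⧸ H, conj X X' q.out f.hom.toLinearMap) fun g => by
    simp only [map_sum]
    rw [← Equiv.sum_comp (MulAction.toPerm g) fun q : G ⧸ H => conj X X' q.out f.hom.toLinearMap]
    refine Finset.sum_congr rfl fun q _ => ?_
    exact (conj_out_smul (conj_res_hom H.range_subtype f) g q).symm

lemma comp_relTrace (H : Subgroup G) [Fintype (G ⧸ H)] {X X' X'' : Rep.{u} k G} (g : X ⟶ X')
    (f : Rep.res H.subtype X' ⟶ Rep.res H.subtype X'') :
    g ≫ relTrace H f = relTrace H ((Rep.resFunctor H.subtype).map g ≫ f) := by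
  have h : ∀ x, conj X X'' x ((Rep.resFunctor H.subtype).map g ≫ f).hom.toLinearMap =
      conj X' X'' x f.hom.toLinearMap ∘ₗ g.hom.toLinearMap := fun x =>
    (conj_comp x g.hom.toLinearMap f.hom.toLinearMap).trans (by rw [conj_hom])
  ext v
  refine Eq.trans ?_ (LinearMap.congr_fun (Finset.sum_congr rfl fun q _ => (h q.out).symm) v)
  simp only [relTrace, homOfConj_hom, Rep.hom_comp_toLinearMap, LinearMap.sum_apply,
    LinearMap.comp_apply]

end RelTrace

/-! ### Null maps -/

section Null

variable {k : Type u} [Field k] {I P : Type u} [Group I] [Group P]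

/-- A homomorphism of `I`-modules is `U`-null if no homomorphism from `U` to its source becomes
split injective after composition with it; equivalently, `Hom^⊕(U, -)` maps it to zero. -/
def Null (j : P →* I) (U : Rep.{u} k P) {A B : Rep.{u} k I} (φ : A ⟶ B) : Prop :=
  ∀ t : U ⟶ Rep.res j A, t ≫ (Rep.resFunctor j).map φ ∈ nonSplit U (Rep.res j B)

variable {j : P →* I} {U : Rep.{u} k P} {A B C : Rep.{u} k I}

lemma Null.zero : Null j U (0 : A ⟶ B) := fun t => by
  rw [Functor.map_zero, comp_zero]
  exact Submodule.zero_mem _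

lemma Null.add {φ ψ : A ⟶ B} (h : Null j U φ) (h' : Null j U ψ) : Null j U (φ + ψ) := fun t => by
  rw [Functor.map_add, Preadditive.comp_add]
  exact Submodule.add_mem _ (h t) (h' t)

lemma Null.neg {φ : A ⟶ B} (h : Null j U φ) : Null j U (-φ) := fun t => by
  rw [Functor.map_neg, Preadditive.comp_neg]
  exact Submodule.neg_mem _ (h t)

lemma Null.sub {φ ψ : A ⟶ B} (h : Null j U φ) (h' : Null j U ψ) : Null j U (φ - ψ) := by
  rw [sub_eq_add_neg]
  exact h.add h'.neg

lemma Null.comp_left {φ : B ⟶ C} (h : Null j U φ) (f : A ⟶ B) : Null j U (f ≫ φ) := fun t => by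
  rw [Functor.map_comp, ← Category.assoc]
  exact h _

lemma Null.comp_right {φ : A ⟶ B} (h : Null j U φ) (f : B ⟶ C) : Null j U (φ ≫ f) := fun t => by
  rw [Functor.map_comp, ← Category.assoc]
  exact nonSplit_comp U _ (h t)

lemma not_null_id [Module.Finite k U] (hU : Indecomposable U) (h : IsSummand U (Rep.res j A)) :
    ¬ Null j U (𝟙 A) := by
  intro hn
  obtain ⟨⟨i, r, hir⟩⟩ := h
  have hi : i ∈ nonSplit U (Rep.res j A) := hn i
  exact (mem_nonSplit_iff hU i).1 hi ⟨⟨⟨r, hir⟩⟩⟩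

end Null

/-! ### Relative traces of maps that factor through a module for the inertia group -/

section Inertia

variable {k : Type u} [Field k] {G : Type u} [Group G]

/-- A bijective linear map `f` with `f (x⁻¹ z x u) = z f u` exhibits an isomorphism between `U` and
its conjugate by `x`. -/
lemma mem_inertia_of_bijective {P : Subgroup G} {U : Rep.{u} k P} {x : G}
    (hx : x ∈ Subgroup.normalizer (P : Set G)) (f : U →ₗ[k] U) (hf : Function.Bijective f)
    (hfx : ∀ z y : P, (y : G) = x⁻¹ * z * x → ∀ u, f (U.ρ y u) = U.ρ z (f u)) :
    x ∈ inertia U := by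
  refine ⟨hx, ?_⟩
  let e : (conjugate ⟨x, hx⟩ U).ρ.Equiv U.ρ :=
    .mk (LinearEquiv.ofBijective f hf) fun z => by
      have hz : x⁻¹ * z * x ∈ P := by
        have := (Subgroup.mem_normalizer_iff.1 (inv_mem hx) z).1 z.2
        simpa using this
      rw [conjugate_ρ ⟨x, hx⟩ U z ⟨_, hz⟩ rfl]
      ext u
      exact hfx z ⟨_, hz⟩ rfl u
  exact ⟨Rep.mkIso e⟩

/-- Modulo `U`-null maps, the relative trace of a homomorphism that factors through `Y` is that
homomorphism itself. -/
theorem null_relTrace_sub [Finite G] {M : Rep.{u} k G} {P : Subgroup G} (hP : IsVertex P M)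
    {U : Rep.{u} k P} [Module.Finite k U] (hU : Indecomposable U) (hMU : IsSummand M (induced U))
    {Y : Rep.{u} k (inertia U)} (hYU : IsSummand Y (inducedToInertia U))
    [Fintype (G ⧸ inertia U)] {X X' : Rep.{u} k G}
    (b : Rep.res (inertia U).subtype X ⟶ Y) (a : Y ⟶ Rep.res (inertia U).subtype X') :
    Null (Subgroup.inclusion (le_inertia U)) U
      ((Rep.resFunctor (inertia U).subtype).map (relTrace (inertia U) (b ≫ a)) - b ≫ a) := by
  classical
  intro t
  rw [mem_nonSplit_iff hU]
  rintro ⟨⟨⟨s, hs⟩⟩⟩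
  have hle : P ≤ inertia U := le_inertia U
  have := Fintype.ofFinite (G ⧸ P)
  have := Fintype.ofFinite (inertia U ⧸ P.subgroupOf (inertia U))
  obtain ⟨β, α, hβα⟩ := exists_sum_of_isSummand_ind (Subgroup.inclusion hle)
    (Subgroup.inclusion_injective hle) (K := P.subgroupOf (inertia U))
    (Subgroup.inclusion_range hle) hYU
  -- inserting the identity of `Y`, a relative trace from `P` of a map through `U`, turns the sum
  -- over the cosets of `I` other than `I` itself into a sum over the cosets of `P` outside `I`,
  -- where `I` is the inertia group
  let θ : X →ₗ[k] X' := a.hom.toLinearMap ∘ₗ (β ≫ α).hom.toLinearMap ∘ₗ b.hom.toLinearMap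
  let θ' : Rep.res P.subtype X ⟶ Rep.res P.subtype X' :=
    (Rep.resFunctor (Subgroup.inclusion hle)).map b ≫ (β ≫ α) ≫
      (Rep.resFunctor (Subgroup.inclusion hle)).map a
  have hθ : ∀ g ∈ P, conj X X' g θ = θ := conj_res_hom P.range_subtype θ'
  have hθI : ∑ y : inertia U ⧸ P.subgroupOf (inertia U), conj X X' (y.out : G) θ =
      (b ≫ a).hom.toLinearMap := by
    have h : ∀ y : inertia U, conj X X' (y : G) θ = a.hom.toLinearMap ∘ₗ
        conj Y Y y (β ≫ α).hom.toLinearMap ∘ₗ b.hom.toLinearMap := by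
      intro y
      change conj (Rep.res (inertia U).subtype X) (Rep.res (inertia U).subtype X') y θ = _
      simp only [θ]
      rw [conj_comp (X' := Y), conj_comp (X' := Y), conj_hom, conj_hom]
    ext v
    have h1 := LinearMap.congr_fun hβα (b.hom v)
    simp only [LinearMap.sum_apply] at h1
    simp only [h, LinearMap.sum_apply, LinearMap.comp_apply, ← map_sum]
    exact congrArg a.hom h1
  have hdiff : ∑ q : G ⧸ P with (QuotientGroup.mk q.out : G ⧸ inertia U) ≠ QuotientGroup.mk 1,
      conj X X' q.out θ =
        (relTrace (inertia U) (b ≫ a)).hom.toLinearMap - (b ≫ a).hom.toLinearMap := by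
    rw [sum_conj_out_of_le hle hθ (fun q => q ≠ QuotientGroup.mk 1), hθI, relTrace, homOfConj_hom,
      ← Finset.add_sum_erase _ _ (Finset.mem_univ (QuotientGroup.mk 1 : G ⧸ inertia U)),
      conj_out (conj_res_hom (inertia U).range_subtype (b ≫ a)), conj, map_one,
      Module.End.one_apply, add_sub_cancel_left, Finset.filter_ne']
  obtain ⟨x, hx, hxS, hbij⟩ := exists_normalizing_coset hP hU hMU (X := X) (X' := X') t s θ hθ
    (Finset.univ.filter fun q : G ⧸ P =>
      (QuotientGroup.mk q.out : G ⧸ inertia U) ≠ QuotientGroup.mk 1) (by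
    intro g hg q hq
    rw [Finset.mem_filter] at hq ⊢
    refine ⟨Finset.mem_univ _, fun h => hq.2 ?_⟩
    obtain ⟨y, rfl⟩ := QuotientGroup.mk_surjective q
    have h' : (QuotientGroup.mk (QuotientGroup.mk (g * y) : G ⧸ P).out : G ⧸ inertia U) =
      QuotientGroup.mk 1 := h
    obtain ⟨z, hz⟩ := QuotientGroup.mk_out_eq_mul P (g * y)
    obtain ⟨w, hw⟩ := QuotientGroup.mk_out_eq_mul P y
    rw [hz] at h'
    rw [hw]
    have h1 := QuotientGroup.eq.1 h'.symm
    refine (QuotientGroup.eq.2 ?_).symm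
    rw [inv_one, one_mul] at h1 ⊢
    refine mul_mem ?_ (hle w.2)
    have h2 := mul_mem (mul_mem (inv_mem (hle hg)) h1) (inv_mem (hle z.2))
    simpa [mul_assoc] using h2) (by
    ext v
    have h1 := LinearMap.congr_fun hdiff (t.hom v)
    simp only [LinearMap.sum_apply] at h1
    simp only [LinearMap.sum_apply, LinearMap.comp_apply, ← map_sum]
    refine (congrArg s.hom h1).trans ?_
    exact LinearMap.congr_fun (congrArg (fun r => r.hom.toLinearMap) hs) v)
  -- the linear map `u ↦ s (x (a (α u)))` identifies `U` with its conjugate by `x`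
  let f : U →ₗ[k] U := s.hom.toLinearMap ∘ₗ X'.ρ x ∘ₗ a.hom.toLinearMap ∘ₗ α.hom.toLinearMap
  have hsurj : Function.Surjective f := by
    intro u
    obtain ⟨v, hv⟩ := hbij.2 u
    exact ⟨β.hom (b.hom (X.ρ x⁻¹ (t.hom v))), hv⟩
  have hxI : x ∈ inertia U := mem_inertia_of_bijective hx f
    ⟨LinearMap.injective_iff_surjective.2 hsurj, hsurj⟩ (by
    intro z y hy u
    have h1 : α.hom (U.ρ y u) = Y.ρ (Subgroup.inclusion hle y) (α.hom u) :=
      Rep.hom_comm_apply α y u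
    have h2 : a.hom (Y.ρ (Subgroup.inclusion hle y) (α.hom u)) = X'.ρ y (a.hom (α.hom u)) :=
      Rep.hom_comm_apply a _ _
    have h3 : s.hom (X'.ρ (z : G) (X'.ρ x (a.hom (α.hom u)))) =
      U.ρ z (s.hom (X'.ρ x (a.hom (α.hom u)))) := Rep.hom_comm_apply s z _
    change s.hom (X'.ρ x (a.hom (α.hom (U.ρ y u)))) = U.ρ z (s.hom (X'.ρ x (a.hom (α.hom u))))
    rw [h1, h2, ← h3, ← Module.End.mul_apply, ← Module.End.mul_apply, ← map_mul, ← map_mul, hy]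
    congr 3
    group)
  refine (Finset.mem_filter.1 hxS).2 ?_
  obtain ⟨w, hw⟩ := QuotientGroup.mk_out_eq_mul P x
  rw [hw]
  refine (QuotientGroup.eq.2 ?_).symm
  rw [inv_one, one_mul]
  exact mul_mem hxI (hle w.2)

end Inertia

/-! ### The isomorphism of functors -/

section Correspondence

variable {k : Type u} [Field k] {G : Type u} [Group G]

lemma isSplitMono_of_comp {X Y Z : Rep.{u} k G} {f : X ⟶ Y} {g : Y ⟶ Z}
    (h : IsSplitMono (f ≫ g)) : IsSplitMono f := by
  obtain ⟨⟨s, hs⟩⟩ := h.exists_splitMono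
  exact ⟨⟨g ≫ s, by simpa using hs⟩⟩

/-- An endomorphism congruent to the identity modulo null maps is not nilpotent, as all its powers
are congruent to the identity; so it is invertible. -/
lemma isIso_of_null_sub {I P : Type u} [Group I] [Group P] {j : P →* I} {U : Rep.{u} k P}
    {R : Rep.{u} k G ⥤ Rep.{u} k I} [R.Additive] {M : Rep.{u} k G} [Module.Finite k M]
    (hM : Indecomposable M) (hn : ¬ Null j U (𝟙 (R.obj M))) (h : M ⟶ M)
    (hh : Null j U (R.map h - 𝟙 _)) : IsIso h := by
  rcases nilpotent_or_unit hM (End.of h) with ⟨n, hnil⟩ | hu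
  · exfalso
    have hpow : ∀ n : ℕ, Null j U (R.map ((End.of h) ^ n : End M) - 𝟙 _) := by
      intro n
      induction n with
      | zero =>
        have : R.map ((End.of h) ^ 0 : End M) - 𝟙 _ = 0 := by
          rw [pow_zero, End.one_def, R.map_id, sub_self]
        rw [this]
        exact Null.zero
      | succ n ih =>
        have : R.map ((End.of h) ^ (n + 1) : End M) - 𝟙 _ =
            (R.map h - 𝟙 _) ≫ R.map ((End.of h) ^ n : End M) +
              (R.map ((End.of h) ^ n : End M) - 𝟙 _) := by
          rw [pow_succ, End.mul_def, R.map_comp, Preadditive.sub_comp, Category.id_comp]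
          change R.map h ≫ _ - _ = _
          abel
        rw [this]
        exact (hh.comp_right _).add ih
    have := (hpow n).neg
    rw [hnil] at this
    change Null j U (-(R.map (0 : M ⟶ M) - 𝟙 _)) at this
    rw [R.map_zero, zero_sub, neg_neg] at this
    exact hn this
  · exact (isUnit_iff_isIso _).1 hu

variable {M : Rep.{u} k G} {I : Subgroup G} {Y : Rep.{u} k I} [Module.Finite k Y]
  [Fintype (G ⧸ I)] {P : Type u} [Group P] {j : P →* I} {U : Rep.{u} k P}

/-- If `i` and `r` realize `M` as a summand of the module induced from `Y`, then `r ≫ i` is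
invertible: modulo null maps `i ≫ (r ≫ i) ^ n ≫ r` is the identity of `M` for all `n`, so `r ≫ i`
is not nilpotent. -/
theorem isIso_of_relTrace_eq_id (hY : Indecomposable Y)
    (hn : ¬ Null j U (𝟙 (Rep.res I.subtype M)))
    (htr : ∀ {X X' : Rep.{u} k G} (b : Rep.res I.subtype X ⟶ Y) (a : Y ⟶ Rep.res I.subtype X'),
      Null j U ((Rep.resFunctor I.subtype).map (relTrace I (b ≫ a)) - b ≫ a))
    (i : Rep.res I.subtype M ⟶ Y) (r : Y ⟶ Rep.res I.subtype M)
    (hir : relTrace I (i ≫ r) = 𝟙 M) : IsIso (r ≫ i) := by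
  have h1 : Null j U (𝟙 (Rep.res I.subtype M) - i ≫ r) := by
    have := htr i r
    rwa [hir, CategoryTheory.Functor.map_id] at this
  rcases nilpotent_or_unit hY (End.of (r ≫ i)) with ⟨n, hnil⟩ | hu
  · exfalso
    have hpow : ∀ n : ℕ, Null j U (𝟙 (Rep.res I.subtype M) -
        i ≫ ((End.of (r ≫ i)) ^ n : End Y) ≫ r) := by
      intro n
      induction n with
      | zero =>
        have : i ≫ ((End.of (r ≫ i)) ^ 0 : End Y) ≫ r = i ≫ r := by
          rw [pow_zero, End.one_def, Category.id_comp]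
        rwa [this]
      | succ n ih =>
        have : 𝟙 (Rep.res I.subtype M) - i ≫ ((End.of (r ≫ i)) ^ (n + 1) : End Y) ≫ r =
            (𝟙 (Rep.res I.subtype M) - i ≫ r) +
            (i ≫ r) ≫ (𝟙 (Rep.res I.subtype M) - i ≫ ((End.of (r ≫ i)) ^ n : End Y) ≫ r) := by
          rw [pow_succ, End.mul_def]
          change 𝟙 _ - i ≫ ((r ≫ i) ≫ _) ≫ r = _
          simp only [Preadditive.comp_sub, Category.comp_id, Category.assoc]
          abel
        rw [this]
        exact h1.add (ih.comp_left _)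
    have := hpow n
    rw [hnil] at this
    change Null j U (𝟙 _ - i ≫ (0 : Y ⟶ Y) ≫ r) at this
    rw [zero_comp, comp_zero, sub_zero] at this
    exact hn this
  · exact (isUnit_iff_isIso _).1 hu

/-- Composition with `r` induces the isomorphism of functors. It is stated for any `U` such that
the identity of `M` is not null and such that relative traces of maps through `Y` do not differ
from these maps modulo null maps. -/
theorem nonempty_homSum_iso [Module.Finite k M] (hM : Indecomposable M) (hY : Indecomposable Y)
    (hn : ¬ Null j U (𝟙 (Rep.res I.subtype M)))
    (htr : ∀ {X X' : Rep.{u} k G} (b : Rep.res I.subtype X ⟶ Y) (a : Y ⟶ Rep.res I.subtype X'),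
      Null j U ((Rep.resFunctor I.subtype).map (relTrace I (b ≫ a)) - b ≫ a))
    (i : Rep.res I.subtype M ⟶ Y) (r : Y ⟶ Rep.res I.subtype M)
    (hir : relTrace I (i ≫ r) = 𝟙 M) :
    Nonempty (homSum M ≅ restrict k I ⋙ homSum Y) := by
  have h1 : Null j U (𝟙 (Rep.res I.subtype M) - i ≫ r) := by
    have := htr i r
    rwa [hir, CategoryTheory.Functor.map_id] at this
  have hu := isIso_of_relTrace_eq_id hY hn htr i r hir
  have hnY : ¬ Null j U (𝟙 Y) := by
    intro h
    have h2 : Null j U (i ≫ r) := by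
      have := (h.comp_left i).comp_right r
      rwa [Category.comp_id] at this
    have := h1.add h2
    rw [sub_add_cancel] at this
    exact hn this
  -- `f` is split injective if and only if `r ≫ f` is
  have hiff : ∀ {X : Rep.{u} k G} (f : M ⟶ X),
      IsSplitMono (r ≫ (restrict k I).map f) ↔ IsSplitMono f := by
    intro X f
    constructor
    · intro hs
      obtain ⟨⟨s, hs⟩⟩ := hs.exists_splitMono
      -- an endomorphism of `M` that factors through `f` and is the identity modulo null maps
      let h : M ⟶ M := relTrace I (((restrict k I).map f ≫ s) ≫ r)
      have hh : Null j U ((Rep.resFunctor I.subtype).map h - 𝟙 _) := by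
        have h2 := htr ((restrict k I).map f ≫ s) r
        have h3 := h1.comp_right (((restrict k I).map f ≫ s) ≫ r)
        have h4 : (𝟙 (Rep.res I.subtype M) - i ≫ r) ≫ ((restrict k I).map f ≫ s) ≫ r =
            ((restrict k I).map f ≫ s) ≫ r - i ≫ r := by
          have := congrArg (fun t => i ≫ t ≫ r) hs
          simp only [Category.assoc, Category.id_comp] at this
          rw [Preadditive.sub_comp, Category.id_comp]
          simp only [Category.assoc]
          rw [this]
        rw [h4] at h3
        have h5 := (h2.add h3).sub h1
        convert h5 using 1
        simp only [h]
        abel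
      have hiso : IsIso h := isIso_of_null_sub hM hn h hh
      have hfac : h = f ≫ relTrace I (s ≫ r) := by
        rw [comp_relTrace, ← Category.assoc]
      rw [hfac] at hiso
      exact isSplitMono_of_comp (inferInstance : IsSplitMono (f ≫ relTrace I (s ≫ r)))
    · rintro ⟨⟨s, hs⟩⟩
      have hs' : (restrict k I).map f ≫ (restrict k I).map s = 𝟙 _ := by
        rw [← Functor.map_comp, hs, CategoryTheory.Functor.map_id]
      refine isSplitMono_of_comp (g := (restrict k I).map s ≫ i) ?_
      have : (r ≫ (restrict k I).map f) ≫ (restrict k I).map s ≫ i = r ≫ i := by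
        rw [Category.assoc, reassoc_of% hs']
      rw [this]
      infer_instance
  -- every `g` is of the form `r ≫ f` modulo maps that are not split
  have hsurj : ∀ {X : Rep.{u} k G} (g : Y ⟶ (restrict k I).obj X), ∃ f : M ⟶ X,
      r ≫ (restrict k I).map f - g ∈ nonSplit Y ((restrict k I).obj X) := by
    intro X g
    refine ⟨relTrace I (i ≫ inv (r ≫ i) ≫ g), (mem_nonSplit_iff hY _).2 ?_⟩
    rintro ⟨⟨s, hs⟩⟩
    have h2 : Null j U (r ≫ ((restrict k I).map (relTrace I (i ≫ inv (r ≫ i) ≫ g)) -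
        i ≫ inv (r ≫ i) ≫ g)) := (htr i (inv (r ≫ i) ≫ g)).comp_left r
    have h3 : r ≫ i ≫ inv (r ≫ i) ≫ g = g := by
      rw [← Category.assoc, IsIso.hom_inv_id_assoc]
    rw [Preadditive.comp_sub, h3] at h2
    have h4 := h2.comp_right s
    rw [hs] at h4
    exact hnY h4
  let Φ : ∀ X : Rep.{u} k G, (M ⟶ X) →ₗ[k] (Y ⟶ (restrict k I).obj X) := fun X =>
    { toFun := fun f => r ≫ (restrict k I).map f
      map_add' := fun f f' => by rw [Functor.map_add, Preadditive.comp_add]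
      map_smul' := fun c f => by
        rw [RingHom.id_apply, Functor.map_smul, Linear.comp_smul] }
  have hker : ∀ (X : Rep.{u} k G) (f : M ⟶ X),
      Φ X f ∈ nonSplit Y ((restrict k I).obj X) ↔ f ∈ nonSplit M X := fun X f => by
    rw [mem_nonSplit_iff hY, mem_nonSplit_iff hM]
    exact not_congr (hiff f)
  have hle : ∀ X, nonSplit M X ≤ (nonSplit Y ((restrict k I).obj X)).comap (Φ X) :=
    fun X f hf => (hker X f).2 hf
  refine ⟨NatIso.ofComponents (fun X => (LinearEquiv.ofBijective
    ((nonSplit M X).mapQ (nonSplit Y ((restrict k I).obj X)) (Φ X) (hle X))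
      ⟨?_, ?_⟩).toModuleIso) ?_⟩
  · rw [← LinearMap.ker_eq_bot, LinearMap.ker_eq_bot']
    intro z hz
    obtain ⟨f, rfl⟩ := Submodule.Quotient.mk_surjective _ z
    rw [Submodule.mapQ_apply] at hz
    exact (Submodule.Quotient.mk_eq_zero _).2
      ((hker X f).1 ((Submodule.Quotient.mk_eq_zero _).1 hz))
  · intro z
    obtain ⟨g, rfl⟩ := Submodule.Quotient.mk_surjective _ z
    obtain ⟨f, hf⟩ := hsurj g
    exact ⟨Submodule.Quotient.mk f, (Submodule.Quotient.eq _).2 hf⟩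
  · intro X X' h
    ext z
    obtain ⟨f, rfl⟩ := Submodule.Quotient.mk_surjective _ z
    have : r ≫ (restrict k I).map (f ≫ h) =
        (r ≫ (restrict k I).map f) ≫ (restrict k I).map h := by
      rw [Functor.map_comp, Category.assoc]
    exact congrArg Submodule.Quotient.mk this

end Correspondence

end

end ModRep


theorem proposition6p3 {k : Type u} [Field k] {G : Type u} [Group G] [Finite G]
    (M : Rep.{u} k G) [Module.Finite k M] (hM : Indecomposable M)
    (P : Subgroup G) (hP : ModRep.IsVertex P M)
    (U : Rep.{u} k P) (hU : ModRep.IsSource U M)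
    (Y : Rep.{u} k (ModRep.inertia U)) (hY : Indecomposable Y)
    (hYU : ModRep.IsSummand Y (ModRep.inducedToInertia U))
    (hYM : ModRep.IsSummand M (ModRep.induced Y)) :
    Nonempty (ModRep.homSum M ≅
      ModRep.restrict k (ModRep.inertia U) ⋙ ModRep.homSum Y) := by
  classical
  have hUfin := hU.finite
  have := Fintype.ofFinite (G ⧸ ModRep.inertia U)
  have hYfin : Module.Finite k Y := ModRep.finite_of_isSummand hYU
  have hUM : ModRep.IsSummand U
      (Rep.res (Subgroup.inclusion (ModRep.le_inertia U))
        (Rep.res (ModRep.inertia U).subtype M)) :=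
    hP.isSummand_res hM hU.indecomposable hU.isSummand
  obtain ⟨i, r, hir⟩ := ModRep.exists_sum_of_isSummand_ind (ModRep.inertia U).subtype
    (ModRep.inertia U).subtype_injective (ModRep.inertia U).range_subtype hYM
  refine ModRep.nonempty_homSum_iso hM hY (ModRep.not_null_id hU.indecomposable hUM)
    (fun b a => ModRep.null_relTrace_sub hP hU.indecomposable hU.isSummand hYU b a) i r ?_
  ext v
  exact LinearMap.congr_fun hir v
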